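/- Let $G$ be a plane triangulation with $n$ nodes, i.e. a simple planar graph with a fixed planar embedding in which the boundary of every face (including the external one) is a triangle. The three nodes of the external face are called external, all other nodes internal; $I$ is the set of internal nodes. Let $R=(T_1,T_2,T_3)$ be a realizer of $G$: the internal edges of $G$ are partitioned into three edge-disjoint trees $T_1,T_2,T_3$, rooted at distinct external nodes, such that the neighbors of each $v\in I$ form six blocks $U_1,D_3,U_2,D_1,U_3,D_2$ in counterclockwise order around $v$, where $U_j$ consists of the parent and $D_j$ of the children of $v$ in $T_j$. For $i\in\{1,2,3\}$ let $\bar T_i$ be the spanning tree of $G$ that consists of $T_i$ and the two external edges incident to the root of $T_i$, and let $\ell_i$ be the labeling of the nodes by $1,\dots,n$ given by the counterclockwise preorder of $\bar T_i$. For a node $v$, let $\deg_i^-(v)$ (respectively $\deg_i^+(v)$) be the number of neighbors $u$ of $v$ in $G$ with $\ell_i(u)<\ell_i(v)$ (respectively $\ell_i(u)>\ell_i(v)$), and let $$H_i=\sum_{v\in I}\min\{\deg_i^+(v),\deg_i^-(v)\}.$$ Then: 1. If $G$ has no internal node of degree three, then $\sum_{i=1}^{3}H_i\ge 5n-15$.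 2. If $G$ has no internal node of degree five, then $\sum_{i=1}^{3}H_i\ge 5n-17$. 3. In general, $\sum_{i=1}^{3}H_i\ge \frac{23n}{5}-16$. -/

import Mathlib

/-- A rotation system of a simple graph `G`: for every node `v`, a permutation `next v` that
permutes the neighbors of `v` in a single cycle. It is read as follows: `next v u` is the neighbor
of `v` that comes immediately after `u` in counterclockwise order around `v`. (The values of
`next v` outside the neighborhood of `v` are irrelevant.) -/
structure RotationSystem {V : Type*} (G : SimpleGraph V) where
  next : V → Equiv.Perm V
  isCycleOn : ∀ v, (next v).IsCycleOn (G.neighborSet v)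

namespace RotationSystem

variable {V : Type*} {G : SimpleGraph V} (ρ : RotationSystem G)

/-- The facial walk with the face on the left-hand side: after the directed edge `(u, v)` comes
`(v, w)`, where `w` is the neighbor of `v` immediately before `u` in counterclockwise order. -/
def faceStep (d : V × V) : V × V := (d.2, (ρ.next d.2).symm d.1)

/-- The face to the left of a directed edge, given by the directed edges on its boundary walk. -/
def faceOf (d : V × V) : Set (V × V) := Set.range fun k : ℕ => ρ.faceStep^[k] d

/-- The set of faces. -/
def faces : Set (Set (V × V)) := {f | ∃ d : V × V, G.Adj d.1 d.2 ∧ f = ρ.faceOf d}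

/-- The number of counterclockwise steps around `v` that lead from the neighbor `a` to the
neighbor `b` (in particular `0` for `b = a`). -/
noncomputable def ccwSteps (v a b : V) : ℕ := sInf {k : ℕ | (ρ.next v)^[k] a = b}

end RotationSystem

/-- A plane triangulation: a connected simple graph with a planar embedding (a rotation system
that satisfies Euler's formula) and a designated external face, in which every face, including
the external one, is bounded by a triangle. -/
structure PlaneTriangulation (V : Type*) where
  graph : SimpleGraph V
  connected : graph.Connected
  rot : RotationSystem graph
  euler : Nat.card V + rot.faces.ncard = graph.edgeSet.ncard + 2
  triangular : ∀ d : V × V, graph.Adj d.1 d.2 → Function.minimalPeriod rot.faceStep d = 3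
  outerFace : Set (V × V)
  outerFace_mem : outerFace ∈ rot.faces

namespace PlaneTriangulation

variable {V : Type*} (G : PlaneTriangulation V)

/-- External nodes: those on the boundary of the external face. -/
def IsExternal (v : V) : Prop := ∃ w, (v, w) ∈ G.outerFace

/-- Internal nodes. -/
def IsInternal (v : V) : Prop := ¬ G.IsExternal v

/-- `uv` is an internal edge: an edge that is not on the boundary of the external face. -/
def IsInternalEdge (u v : V) : Prop :=
  G.graph.Adj u v ∧ (u, v) ∉ G.outerFace ∧ (v, u) ∉ G.outerFace

/-- The degree of a node. -/
noncomputable def deg (v : V) : ℕ := (G.graph.neighborSet v).ncard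

open Classical in
/-- The finite set of internal nodes. -/
noncomputable def internalNodes [Fintype V] : Finset V :=
  Finset.univ.filter fun v => G.IsInternal v

/-- A realizer `(T 0, T 1, T 2)` of a plane triangulation. The rooted tree `T j` is given by its
root, an external node, and the parent in `T j` of each internal node; its edges join the internal
nodes to their parents. By convention `parent j` fixes the external nodes. -/
structure Realizer where
  root : Fin 3 → V
  parent : Fin 3 → V → V
  root_injective : Function.Injective root
  root_external : ∀ j, G.IsExternal (root j)
  parent_external : ∀ j v, G.IsExternal v → parent j v = v
  parent_adj : ∀ j v, G.IsInternal v → G.graph.Adj v (parent j v)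
  /-- `T j` is a tree with root `root j`. -/
  reaches_root : ∀ j v, G.IsInternal v → ∃ k : ℕ, (parent j)^[k] v = root j
  /-- The internal edges are partitioned into the edges of the three trees. -/
  partition : ∀ u v, G.IsInternalEdge u v → ∃! j, parent j u = v ∨ parent j v = u
  /-- Around an internal node, starting at the parent in `T 0`, the neighbors form the six blocks
  `U 0`, `D 2`, `U 1`, `D 0`, `U 2`, `D 1` in counterclockwise order, where `U j` consists of the
  parent in `T j` and `D j` of the children in `T j`. -/
  blocks : ∀ v, G.IsInternal v →
    let U : Fin 3 → Set V := fun j => {parent j v}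
    let D : Fin 3 → Set V := fun j => {u | G.IsInternal u ∧ parent j u = v}
    let block : Fin 6 → Set V := ![U 0, D 2, U 1, D 0, U 2, D 1]
    ∀ s t : Fin 6, s < t → ∀ a ∈ block s, ∀ b ∈ block t,
      G.rot.ccwSteps v (parent 0 v) a < G.rot.ccwSteps v (parent 0 v) b

namespace Realizer

variable {G} (R : G.Realizer) (i : Fin 3)

open Classical in
/-- The parent in the spanning tree that consists of `T i` and the two external edges incident to
the root of `T i`. By convention the root is its own parent. -/
noncomputable def spanParent (v : V) : V := if G.IsInternal v then R.parent i v else R.root i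

/-- `a` is a child of `w` in the spanning tree. -/
def IsChild (w a : V) : Prop := a ≠ R.root i ∧ R.spanParent i a = w

/-- `u` is `v` or a proper ancestor of `v` in the spanning tree. -/
def IsAncestor (u v : V) : Prop := ∃ k : ℕ, (R.spanParent i)^[k] v = u

/-- The children `a`, `b` of `w` satisfy: `a` comes before `b` in counterclockwise order around
`w`. The order starts immediately after the neighbor `x` of `w`: this is the parent of `w` if `w`
is internal; if `w` is the root, the angle from `x` to `next w x` is the one in the external
face. -/
def SiblingLT (w a b : V) : Prop :=
  ∃ x, ((G.IsInternal w ∧ x = R.parent i w) ∨ (w, x) ∈ G.outerFace) ∧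
    G.rot.ccwSteps w (G.rot.next w x) a < G.rot.ccwSteps w (G.rot.next w x) b

/-- `u` comes before `v` in the counterclockwise preorder of the spanning tree: a node comes
before its proper descendants, and the subtrees of the children of a node are traversed one after
the other in counterclockwise order. -/
def Precedes (u v : V) : Prop :=
  (u ≠ v ∧ R.IsAncestor i u v) ∨
    ∃ w a b, R.IsChild i w a ∧ R.IsChild i w b ∧ R.SiblingLT i w a b ∧
      R.IsAncestor i a u ∧ R.IsAncestor i b v

/-- The labeling `ℓ i` with labels `1, …, n` by counterclockwise preorder. -/
noncomputable def label (v : V) : ℕ := {u | R.Precedes i u v}.ncard + 1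

/-- The number of neighbors of `v` with smaller label. -/
noncomputable def degMinus (v : V) : ℕ :=
  {u | G.graph.Adj v u ∧ R.label i u < R.label i v}.ncard

/-- The number of neighbors of `v` with larger label. -/
noncomputable def degPlus (v : V) : ℕ :=
  {u | G.graph.Adj v u ∧ R.label i v < R.label i u}.ncard

/-- The sum of `min (deg⁺ v) (deg⁻ v)` over the internal nodes `v`. -/
noncomputable def score [Fintype V] : ℕ :=
  ∑ v ∈ G.internalNodes, min (R.degPlus i v) (R.degMinus i v)

end Realizer

end PlaneTriangulation

/-!
Write `d j` for the number of children of an internal node `v` in the tree `T j`, with indices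
modulo three. The neighbors of `v` that come, counterclockwise, after its parent and before its
children in `T i` are the `d (i + 2)` children in `T (i + 2)` and the parent in `T (i + 1)`. They
precede `v` in the preorder of the `i`-th spanning tree, as does its parent in `T i`, and the other
neighbors follow `v`. Hence `v` contributes `min (1 + d i + d (i + 1)) (2 + d (i + 2))` to the
`i`-th score, and the rest is counting.

The statement on the preorder (`isLeftOf_of_mem`) needs no Jordan curve argument. Let `y`, `x` be
consecutive neighbors of `v`, where `y` is the parent of `v` in `T i` or is already known to lie to
the left of `v`, and `x` is in one of the two blocks. The blocks around `x` show that `y` is the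
parent of `x` in `T i` or `x` is the parent of `y` in `T (i + 1)`. In the first case `x` is the
sibling just before `v` or a descendant of a node to the left of `v`; in the second one induction
along the preorder puts `x` to the left of `y`.

Let `f` be the sum of the three contributions of a node to the scores, and let `k` be the number
of `j` with `d j > 0`. Then `f ≥ 5` unless the degree is three (`f = 3`), and `f ≥ 3 + 2 k` unless
the degree is five. The first bound gives the first claim. For the second one, `sum_empty_le` says
that the sum of `k` over the `m = n - 3` internal nodes is at least `m - 1`: by Euler's formula
there are `2 m + 1` internal faces, and different pairs `(v, j)` with `d j = 0` belong to different
ones.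
The third claim also needs a bound for the number of nodes of degree three, `sum_leaf_le`: up to
three exceptions, each of them is the first or last child in `T j` of a node with `d j ≥ 2`, because
among the three edges between its neighbors two point in the same direction around the triangle.
-/

/-! ### Indices of the trees, modulo three -/

theorem fin_three_add_one_add_two (j : Fin 3) : j + 1 + 2 = j := by decide +revert

theorem fin_three_add_two_add_one (j : Fin 3) : j + 2 + 1 = j := by decide +revert

theorem fin_three_add_two_add_two (j : Fin 3) : j + 2 + 2 = j + 1 := by decide +revert

theorem fin_three_add_one_ne (j : Fin 3) : j + 1 ≠ j := by decide +revert

theorem fin_three_add_two_ne (j : Fin 3) : j + 2 ≠ j := by decide +revert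

/-! ### Rotation systems -/

namespace RotationSystem

variable {V : Type*} {G : SimpleGraph V} (ρ : RotationSystem G) {v a b c : V}

theorem adj_next (h : G.Adj v a) : G.Adj v (ρ.next v a) := (ρ.isCycleOn v).1.mapsTo h

theorem adj_next_symm (h : G.Adj v a) : G.Adj v ((ρ.next v).symm a) := by
  obtain ⟨w, hw, rfl⟩ := (ρ.isCycleOn v).1.surjOn h
  simpa using hw

theorem exists_iterate [Finite V] (ha : G.Adj v a) (hb : G.Adj v b) :
    ∃ k : ℕ, (ρ.next v)^[k] a = b := by
  obtain ⟨k, hk⟩ := (ρ.isCycleOn v).exists_pow_eq' (Set.toFinite _) ha hb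
  exact ⟨k, by rw [Equiv.Perm.iterate_eq_pow, hk]⟩

theorem iterate_ccwSteps [Finite V] (ha : G.Adj v a) (hb : G.Adj v b) :
    (ρ.next v)^[ρ.ccwSteps v a b] a = b :=
  Nat.sInf_mem (s := {k : ℕ | (ρ.next v)^[k] a = b}) (ρ.exists_iterate ha hb)

theorem ccwSteps_le {k : ℕ} (h : (ρ.next v)^[k] a = b) : ρ.ccwSteps v a b ≤ k := Nat.sInf_le h

theorem ccwSteps_self : ρ.ccwSteps v a a = 0 :=
  Nat.le_zero.1 (ρ.ccwSteps_le (k := 0) rfl)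

theorem ccwSteps_injective [Finite V] (ha : G.Adj v a) (hb : G.Adj v b) (hc : G.Adj v c)
    (h : ρ.ccwSteps v a b = ρ.ccwSteps v a c) : b = c := by
  rw [← ρ.iterate_ccwSteps ha hb, h, ρ.iterate_ccwSteps ha hc]

theorem ccwSteps_next [Finite V] (ha : G.Adj v a) (hb : G.Adj v b) (h : ρ.next v b ≠ a) :
    ρ.ccwSteps v a (ρ.next v b) = ρ.ccwSteps v a b + 1 := by
  apply le_antisymm
  · apply ρ.ccwSteps_le
    rw [Function.iterate_succ_apply', ρ.iterate_ccwSteps ha hb]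
  · have h1 := ρ.iterate_ccwSteps ha (ρ.adj_next hb)
    rcases hk : ρ.ccwSteps v a (ρ.next v b) with _ | k
    · rw [hk] at h1
      exact absurd h1.symm h
    · rw [hk, Function.iterate_succ_apply'] at h1
      have := ρ.ccwSteps_le ((ρ.next v).injective h1)
      omega

/-- The neighbor just before `a` comes last when the counting starts at `a`. -/
theorem ccwSteps_le_of_next_eq [Finite V] (ha : G.Adj v a) (hb : G.Adj v b) (hc : G.Adj v c)
    (h : ρ.next v b = a) : ρ.ccwSteps v a c ≤ ρ.ccwSteps v a b := by
  by_contra! hlt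
  have h1 := ρ.iterate_ccwSteps ha hc
  obtain ⟨l, hl⟩ := Nat.exists_eq_add_of_lt hlt
  rw [hl, show ρ.ccwSteps v a b + l + 1 = l + (ρ.ccwSteps v a b + 1) by ring,
    Function.iterate_add_apply, Function.iterate_succ_apply', ρ.iterate_ccwSteps ha hb, h] at h1
  have := ρ.ccwSteps_le h1
  omega

/-- A set that contains one neighbor of `v` and is closed under `next v` contains all of them. -/
theorem mem_of_next_mem [Finite V] {s : Set V} (ha : G.Adj v a) (hs : a ∈ s)
    (h : ∀ x ∈ s, ρ.next v x ∈ s) (hb : G.Adj v b) : b ∈ s := by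
  obtain ⟨k, rfl⟩ := ρ.exists_iterate ha hb
  clear hb
  induction k with
  | zero => exact hs
  | succ k ih => rw [Function.iterate_succ_apply']; exact h _ ih

end RotationSystem

/-! ### Triangular faces and the external face -/

namespace PlaneTriangulation

variable {V : Type*} (G : PlaneTriangulation V)

theorem faceStep_three {d : V × V} (h : G.graph.Adj d.1 d.2) :
    G.rot.faceStep (G.rot.faceStep (G.rot.faceStep d)) = d := by
  have := Function.isPeriodicPt_minimalPeriod G.rot.faceStep d
  rw [G.triangular d h] at this
  exact this

/-- If `y`, `x` are consecutive neighbors of `v`, then `v`, `y`, `x` is a triangular face. -/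
theorem next_rotate {v x y : V} (h : G.graph.Adj v y) (hx : G.rot.next v y = x) :
    G.rot.next y x = v ∧ G.rot.next x v = y := by
  have h1 : G.graph.Adj x v := hx ▸ (G.rot.adj_next h).symm
  have h2 := G.faceStep_three (d := (x, v)) h1
  have h3 : (G.rot.next v).symm x = y := by rw [← hx]; simp
  simp only [RotationSystem.faceStep, h3, Prod.mk.injEq] at h2
  obtain ⟨h4, h5⟩ := h2
  rw [h4] at h5
  exact ⟨by rw [← h4]; simp, by rw [← h5]; simp⟩

theorem adj_of_next {v x y : V} (h : G.graph.Adj v y) (hx : G.rot.next v y = x) :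
    G.graph.Adj y x := by
  have h1 := (G.next_rotate h hx).1
  have h2 := G.rot.adj_next_symm h.symm
  rw [← h1] at h2
  simpa using h2

theorem mem_faceOf_iff {d e : V × V} (h : G.graph.Adj d.1 d.2) :
    e ∈ G.rot.faceOf d ↔
      e = d ∨ e = G.rot.faceStep d ∨ e = G.rot.faceStep (G.rot.faceStep d) := by
  constructor
  · rintro ⟨k, rfl⟩
    induction k with
    | zero => simp
    | succ k ih =>
      simp only [Function.iterate_succ_apply'] at ih ⊢
      rcases ih with ih | ih | ih <;> rw [ih]
      · simp
      · simp
      · left; exact G.faceStep_three h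
  · rintro (rfl | rfl | rfl)
    exacts [⟨0, rfl⟩, ⟨1, rfl⟩, ⟨2, rfl⟩]

/-- The external face is a triangle `a`, `b`, `c`. -/
theorem exists_outerFace_eq : ∃ a b c : V, a ≠ b ∧ b ≠ c ∧ c ≠ a ∧
    G.graph.Adj a b ∧ G.graph.Adj b c ∧ G.graph.Adj c a ∧
    G.rot.next b c = a ∧ G.rot.next c a = b ∧ G.rot.next a b = c ∧
    G.outerFace = {(a, b), (b, c), (c, a)} := by
  obtain ⟨⟨a, b⟩, hab, ho⟩ := G.outerFace_mem
  simp only at hab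
  set c := (G.rot.next b).symm a with hc
  have hbc : G.graph.Adj b c := G.rot.adj_next_symm hab.symm
  have h1 : G.rot.next b c = a := by simp [hc]
  obtain ⟨h2, h3⟩ := G.next_rotate hbc h1
  have hca := G.adj_of_next hbc h1
  refine ⟨a, b, c, hab.ne, hbc.ne, hca.ne, hab, hbc, hca, h1, h2, h3, ?_⟩
  ext e
  rw [ho, G.mem_faceOf_iff hab]
  have e1 : G.rot.faceStep (a, b) = (b, c) := rfl
  have e2 : G.rot.faceStep (b, c) = (c, a) := by
    simp only [RotationSystem.faceStep, Prod.mk.injEq, true_and]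
    rw [← h2]; simp
  rw [e1, e2]; rfl

theorem adj_of_mem_outerFace {d : V × V} (h : d ∈ G.outerFace) : G.graph.Adj d.1 d.2 := by
  obtain ⟨a, b, c, -, -, -, hab, hbc, hca, -, -, -, ho⟩ := G.exists_outerFace_eq
  rw [ho] at h
  rcases h with rfl | rfl | rfl
  exacts [hab, hbc, hca]

theorem faceStep_mem_outerFace {d : V × V} (h : d ∈ G.outerFace) :
    G.rot.faceStep d ∈ G.outerFace := by
  obtain ⟨e, -, ho⟩ := G.outerFace_mem
  rw [ho] at h ⊢
  obtain ⟨k, rfl⟩ := h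
  exact ⟨k + 1, Function.iterate_succ_apply' _ _ _⟩

theorem outerFace_unique {w x y : V} (hx : (w, x) ∈ G.outerFace) (hy : (w, y) ∈ G.outerFace) :
    x = y := by
  obtain ⟨a, b, c, hab, hbc, hca, -, -, -, -, -, -, ho⟩ := G.exists_outerFace_eq
  simp only [ho, Set.mem_insert_iff, Set.mem_singleton_iff, Prod.mk.injEq] at hx hy
  grind

theorem isExternal_right {u v : V} (h : (u, v) ∈ G.outerFace) : G.IsExternal v := by
  obtain ⟨a, b, c, -, -, -, -, -, -, -, -, -, ho⟩ := G.exists_outerFace_eq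
  unfold IsExternal
  simp only [ho, Set.mem_insert_iff, Set.mem_singleton_iff, Prod.mk.injEq] at h ⊢
  grind

theorem isInternalEdge {u v : V} (hv : G.IsInternal v) (h : G.graph.Adj v u) :
    G.IsInternalEdge v u :=
  ⟨h, fun h' => hv ⟨_, h'⟩, fun h' => hv (G.isExternal_right h')⟩

/-! ### Parents and children around a node -/

namespace Realizer

variable {G} (R : G.Realizer)

/-- There are only three external nodes, so all of them are roots. -/
theorem isExternal_iff {v : V} : G.IsExternal v ↔ ∃ j, v = R.root j := by
  classical
  obtain ⟨a, b, c, hab, hbc, hca, -, -, -, -, -, -, ho⟩ := G.exists_outerFace_eq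
  have hext : ∀ w, G.IsExternal w ↔ w ∈ ({a, b, c} : Finset V) := by
    intro w
    unfold IsExternal
    simp only [ho, Set.mem_insert_iff, Set.mem_singleton_iff, Prod.mk.injEq, Finset.mem_insert,
      Finset.mem_singleton]
    grind
  have hsub : Finset.univ.image R.root ⊆ ({a, b, c} : Finset V) := by
    intro w hw
    obtain ⟨j, -, rfl⟩ := Finset.mem_image.1 hw
    exact (hext _).1 (R.root_external j)
  have hcard := Finset.card_image_of_injective Finset.univ R.root_injective
  have heq := Finset.eq_of_subset_of_card_le hsub
    (by rw [hcard]; simpa using Finset.card_le_three)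
  rw [hext, ← heq]
  simp [eq_comm]

theorem not_isInternal_root (j : Fin 3) : ¬ G.IsInternal (R.root j) :=
  fun h => h (R.root_external j)

/-- External nodes are fixed by `parent j`, so a path in `T j` that ends in `root j` cannot pass
through another external node. -/
theorem parent_eq_root {j : Fin 3} {v : V} (hv : G.IsInternal v)
    (h : G.IsExternal (R.parent j v)) : R.parent j v = R.root j := by
  obtain ⟨k, hk⟩ := R.reaches_root j v hv
  cases k with
  | zero => exact absurd ((show v = _ from hk) ▸ R.root_external j) hv
  | succ k =>
    rw [Function.iterate_succ_apply, Function.iterate_fixed (R.parent_external j _ h)] at hk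
    exact hk

/-- An edge at an internal node belongs to only one of the trees. -/
theorem eq_index {v u : V} {j k : Fin 3} (hv : G.IsInternal v) (h : G.graph.Adj v u)
    (hj : R.parent j v = u ∨ R.parent j u = v) (hk : R.parent k v = u ∨ R.parent k u = v) :
    j = k :=
  (R.partition v u (G.isInternalEdge hv h)).unique hj hk

theorem parent_inj {v : V} {j k : Fin 3} (hv : G.IsInternal v)
    (h : R.parent j v = R.parent k v) : j = k :=
  R.eq_index hv (R.parent_adj j v hv) (Or.inl rfl) (Or.inl h.symm)

/-- A parent of `v` is never a child of `v`. -/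
theorem parent_parent_ne {v : V} {j k : Fin 3} (hv : G.IsInternal v) :
    R.parent k (R.parent j v) ≠ v := by
  intro h
  obtain rfl := R.eq_index hv (R.parent_adj j v hv) (Or.inl rfl) (Or.inr h)
  have hu : G.IsInternal (R.parent j v) := by
    intro he
    rw [R.parent_external j _ he] at h
    rw [h] at he
    exact hv he
  obtain ⟨k, hk⟩ := R.reaches_root j v hv
  have : ∀ k : ℕ, G.IsInternal ((R.parent j)^[k] v) ∧
      ((R.parent j)^[k] v = v ∨ (R.parent j)^[k] v = R.parent j v) := by
    intro k
    induction k with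
    | zero => exact ⟨hv, Or.inl rfl⟩
    | succ k ih =>
      rw [Function.iterate_succ_apply']
      rcases ih.2 with h' | h' <;> rw [h']
      · exact ⟨hu, Or.inr rfl⟩
      · exact ⟨by rwa [h], Or.inl h⟩
  exact R.not_isInternal_root j (hk ▸ (this k).1)

/-- The set `D j` of children of `v` in the tree `T j`. -/
def children (j : Fin 3) (v : V) : Set V := {u | G.IsInternal u ∧ R.parent j u = v}

theorem children_adj {j : Fin 3} {u v : V} (h : u ∈ R.children j v) : G.graph.Adj v u := by
  have := R.parent_adj j u h.1
  rw [h.2] at this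
  exact this.symm

theorem parent_notMem_children {j k : Fin 3} {v : V} (hv : G.IsInternal v) :
    R.parent j v ∉ R.children k v :=
  fun h => R.parent_parent_ne hv h.2

theorem children_index {j k : Fin 3} {u v : V} (hj : u ∈ R.children j v)
    (hk : u ∈ R.children k v) : j = k :=
  R.parent_inj hj.1 (hj.2.trans hk.2.symm)

theorem adj_iff {v u : V} (hv : G.IsInternal v) :
    G.graph.Adj v u ↔ (∃ j, u = R.parent j v) ∨ ∃ j, u ∈ R.children j v := by
  constructor
  · intro h
    obtain ⟨j, hj, -⟩ := R.partition v u (G.isInternalEdge hv h)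
    rcases hj with hj | hj
    · exact Or.inl ⟨j, hj.symm⟩
    · refine Or.inr ⟨j, fun he => ?_, hj⟩
      rw [R.parent_external j u he] at hj
      exact h.ne hj.symm
  · rintro (⟨j, rfl⟩ | ⟨j, h⟩)
    · exact R.parent_adj j v hv
    · exact R.children_adj h

theorem eq_parent_of_adj_root {v : V} {j : Fin 3} (hv : G.IsInternal v)
    (h : G.graph.Adj v (R.root j)) : R.root j = R.parent j v := by
  rcases (R.adj_iff hv).1 h with ⟨k, hk⟩ | ⟨k, hk⟩
  · have h1 := R.parent_eq_root hv (hk ▸ R.root_external j : G.IsExternal (R.parent k v))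
    rw [h1] at hk
    rwa [R.root_injective hk, ← R.root_injective hk, eq_comm, R.root_injective hk]
  · exact absurd hk.1 (R.not_isInternal_root j)

/-- The element after a neighbor `x` in the `s`-th block lies in the same block or in a later one
with only empty blocks between, where the first block follows the last one. -/
theorem next_mem_block [Finite V] {v x : V} (hv : G.IsInternal v)
    (hx : G.graph.Adj v x) :
    let block : Fin 6 → Set V := ![{R.parent 0 v}, R.children 2 v, {R.parent 1 v},
      R.children 0 v, {R.parent 2 v}, R.children 1 v]
    ∀ s t : Fin 6, x ∈ block s → G.rot.next v x ∈ block t →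
      (s ≤ t ∧ ∀ r, s < r → r < t → block r = ∅) ∨
      (t = 0 ∧ ∀ r, s < r → block r = ∅) := by
  intro block s t hs ht
  have hb : ∀ s t : Fin 6, s < t → ∀ a ∈ block s, ∀ b ∈ block t,
      G.rot.ccwSteps v (R.parent 0 v) a < G.rot.ccwSteps v (R.parent 0 v) b := R.blocks v hv
  have h0 := R.parent_adj 0 v hv
  have hadj : ∀ r, ∀ y ∈ block r, G.graph.Adj v y := by
    intro r y hy
    rw [R.adj_iff hv]
    fin_cases r
    exacts [Or.inl ⟨_, hy⟩, Or.inr ⟨_, hy⟩, Or.inl ⟨_, hy⟩, Or.inr ⟨_, hy⟩, Or.inl ⟨_, hy⟩,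
      Or.inr ⟨_, hy⟩]
  by_cases hn : G.rot.next v x = R.parent 0 v
  · right
    constructor
    · by_contra h
      have := hb 0 t (Fin.pos_of_ne_zero h) (R.parent 0 v) rfl _ ht
      rw [hn] at this
      omega
    · intro r hr
      by_contra! h
      obtain ⟨y, hy⟩ := h
      have h1 := hb s r hr x hs y hy
      have h2 := G.rot.ccwSteps_le_of_next_eq h0 hx (hadj r y hy) hn
      omega
  · left
    have h1 := G.rot.ccwSteps_next h0 hx hn
    refine ⟨?_, ?_⟩
    · by_contra! h
      have := hb t s h _ ht _ hs
      omega
    · intro r hr hr'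
      by_contra! h
      obtain ⟨y, hy⟩ := h
      have h2 := hb s r hr x hs y hy
      have h3 := hb r t hr' y hy _ ht
      omega

/-- Around an internal node `v`, the parent in `T i` and the children in `T (i + 2)` are followed by
children in `T (i + 2)` and then by the parent in `T (i + 1)`. -/
theorem next_parent_or_child [Finite V] {v x : V} (i : Fin 3) (hv : G.IsInternal v)
    (hx : x = R.parent i v ∨ x ∈ R.children (i + 2) v) :
    G.rot.next v x ∈ R.children (i + 2) v ∨ G.rot.next v x = R.parent (i + 1) v := by
  have hadj : G.graph.Adj v x := (R.adj_iff hv).2 (hx.imp (fun h => ⟨_, h⟩) fun h => ⟨_, h⟩)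
  have hne : x = R.parent i v → G.rot.next v x ≠ R.parent i v := by
    rintro rfl h
    have hall : ∀ y, G.graph.Adj v y → y = R.parent i v := fun y hy =>
      G.rot.mem_of_next_mem (s := {R.parent i v}) hadj rfl (by rintro _ rfl; exact h) hy
    exact fin_three_add_one_ne i (R.parent_inj hv (hall _ (R.parent_adj (i + 1) v hv)))
  have key := R.next_mem_block hv hadj
  set block : Fin 6 → Set V := ![{R.parent 0 v}, R.children 2 v, {R.parent 1 v},
      R.children 0 v, {R.parent 2 v}, R.children 1 v]
  -- `U k` and `D (k + 2)` are the blocks with numbers `2 k` and `2 k + 1`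
  have hU : ∀ k : Fin 3, block (![0, 2, 4] k) = {R.parent k v} := by
    intro k; fin_cases k <;> rfl
  have hD : ∀ k : Fin 3, block (![1, 3, 5] k) = R.children (k + 2) v := by
    intro k; fin_cases k <;> rfl
  have hU' : ∀ k : Fin 3, block (![0, 2, 4] k) ≠ ∅ := by
    intro k; rw [hU]; exact Set.singleton_ne_empty _
  have key' : ∀ s t : Fin 6, x ∈ block s → G.rot.next v x ∈ block t →
      (s ≤ t ∧ ∀ k : Fin 3, s < ![0, 2, 4] k → ¬ ![0, 2, 4] k < t) ∨
      (t = 0 ∧ ∀ k : Fin 3, ¬ s < ![0, 2, 4] k) := by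
    intro s t hs ht
    rcases key s t hs ht with ⟨h1, h2⟩ | ⟨h1, h2⟩
    · exact Or.inl ⟨h1, fun k hk hk' => hU' k (h2 _ hk hk')⟩
    · exact Or.inr ⟨h1, fun k hk => hU' k (h2 _ hk)⟩
  have hcases : (∃ k : Fin 3, G.rot.next v x ∈ block (![0, 2, 4] k)) ∨
      ∃ k : Fin 3, G.rot.next v x ∈ block (![1, 3, 5] k) := by
    rcases (R.adj_iff hv).1 (G.rot.adj_next hadj) with ⟨j, hj⟩ | ⟨j, hj⟩
    · exact Or.inl ⟨j, by rw [hU]; exact hj⟩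
    · refine Or.inr ⟨j + 1, ?_⟩
      rw [hD, fin_three_add_one_add_two]
      exact hj
  rcases hx with hx | hx
  · have hs : x ∈ block (![0, 2, 4] i) := by rw [hU]; exact hx
    rcases hcases with ⟨k, hk⟩ | ⟨k, hk⟩
    · have h1 := key' _ _ hs hk
      rw [hU] at hk
      have h2 : k ≠ i := by rintro rfl; exact hne hx hk
      have h3 : k = i + 1 := by clear hk hs hne hx; revert i k; decide
      exact Or.inr (h3 ▸ hk)
    · have h1 := key' _ _ hs hk
      have h3 : k = i := by clear hk hs hne hx; revert i k; decide
      rw [hD, h3] at hk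
      exact Or.inl hk
  · have hs : x ∈ block (![1, 3, 5] i) := by rw [hD]; exact hx
    rcases hcases with ⟨k, hk⟩ | ⟨k, hk⟩
    · have h1 := key' _ _ hs hk
      rw [hU] at hk
      have h3 : k = i + 1 := by clear hk hs hne hx; revert i k; decide
      exact Or.inr (h3 ▸ hk)
    · have h1 := key' _ _ hs hk
      have h3 : k = i := by clear hk hs hne hx; revert i k; decide
      rw [hD, h3] at hk
      exact Or.inl hk

/-- The neighbor before a child in `T (i + 2)` or before the parent in `T (i + 1)` is another child
in `T (i + 2)` or the parent in `T i`. -/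
theorem parent_or_child_of_next [Finite V] {v y : V} (i : Fin 3) (hv : G.IsInternal v)
    (hy : G.graph.Adj v y)
    (h : G.rot.next v y ∈ R.children (i + 2) v ∨ G.rot.next v y = R.parent (i + 1) v) :
    y = R.parent i v ∨ y ∈ R.children (i + 2) v := by
  have aux : ∀ k, (y = R.parent k v ∨ y ∈ R.children (k + 2) v) → k = i := by
    intro k hk
    rcases R.next_parent_or_child k hv hk with h1 | h1 <;> rcases h with h2 | h2
    · simpa using R.children_index h1 h2
    · exact absurd (h2 ▸ h1) (R.parent_notMem_children hv)
    · exact absurd (h1 ▸ h2) (R.parent_notMem_children hv)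
    · simpa using R.parent_inj hv (h1.symm.trans h2)
  rcases (R.adj_iff hv).1 hy with ⟨k, hk⟩ | ⟨k, hk⟩
  · obtain rfl := aux k (Or.inl hk)
    exact Or.inl hk
  · have hk' := fin_three_add_one_add_two k
    obtain rfl := aux (k + 1) (Or.inr (hk'.symm ▸ hk))
    rw [hk']
    exact Or.inr hk

theorem exists_child_root {v : V} (hv : G.IsInternal v) (j : Fin 3) :
    ∃ w, w ∈ R.children j (R.root j) := by
  obtain ⟨k, hk⟩ := R.reaches_root j v hv
  induction k generalizing v with
  | zero => exact absurd ((show v = _ from hk) ▸ R.root_external j) hv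
  | succ k ih =>
    by_cases h : G.IsExternal (R.parent j v)
    · exact ⟨v, hv, R.parent_eq_root hv h⟩
    · exact ih h (by rwa [Function.iterate_succ_apply] at hk)

/-! ### The roots on the external face -/

/-- The external face has the directed edges from `root (i + 1)` to `root i`: the internal
node that forms a triangle with two external nodes has them as consecutive parents, and the blocks
around it fix their cyclic order. -/
theorem root_mem_outerFace [Finite V] {v : V} (hv : G.IsInternal v) (i : Fin 3) :
    (R.root (i + 1), R.root i) ∈ G.outerFace := by
  obtain ⟨a, b, c, hab, hbc, hca, aab, abc, aca, n1, n2, n3, ho⟩ := G.exists_outerFace_eq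
  have key : ∀ a b c : V, a ≠ b → b ≠ c → c ≠ a → G.graph.Adj a b → G.rot.next b c = a →
      G.outerFace = {(a, b), (b, c), (c, a)} → ∃ t, a = R.root (t + 1) ∧ b = R.root t := by
    clear! a b c
    intro a b c hab hbc hca aab n1 ho
    have ha : G.IsExternal a := ⟨b, by simp [ho]⟩
    have hb : G.IsExternal b := ⟨c, by simp [ho]⟩
    obtain ⟨t, rfl⟩ := R.isExternal_iff.1 hb
    obtain ⟨s, rfl⟩ := R.isExternal_iff.1 ha
    obtain ⟨w, hw⟩ := R.exists_child_root hv t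
    set u := G.rot.next (R.root t) (R.root s) with hu
    -- The third node `u` of the other face at the edge `ab` is internal: otherwise `b` would have
    -- no neighbors besides `a` and `c`, but it has a child.
    have hu' : G.IsInternal u := by
      intro hue
      have huc : u = c := by
        obtain ⟨z, hz⟩ := hue
        simp only [ho, Set.mem_insert_iff, Set.mem_singleton_iff, Prod.mk.injEq] at hz
        have h1 := (G.rot.adj_next aab.symm).ne
        have h2 := (G.adj_of_next aab.symm hu.symm).ne
        grind
      have := G.rot.mem_of_next_mem (s := {R.root s, c}) aab.symm (by simp)
        (by
          rintro x (rfl | rfl)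
          · right; rw [← huc]; rfl
          · left; exact n1) (R.children_adj hw)
      rcases this with h | h
      · exact hw.1 (h ▸ ha)
      · exact hw.1 ((show w = c from h) ▸ ⟨R.root s, by simp [ho]⟩)
    obtain ⟨h1, h2⟩ := G.next_rotate aab.symm hu.symm
    have hut := R.eq_parent_of_adj_root hu' (G.rot.adj_next aab.symm).symm
    have h3 := R.next_parent_or_child t hu' (Or.inl hut)
    rw [h2] at h3
    rcases h3 with h3 | h3
    · exact absurd h3.1 (R.not_isInternal_root s)
    · exact ⟨t, h3.trans (R.parent_eq_root hu' (h3 ▸ ha)), rfl⟩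
  have key' : ∀ d ∈ G.outerFace, ∃ t, d = (R.root (t + 1), R.root t) := by
    have r1 : G.outerFace = {(b, c), (c, a), (a, b)} := by
      rw [ho]; ext; simp only [Set.mem_insert_iff, Set.mem_singleton_iff]; tauto
    have r2 : G.outerFace = {(c, a), (a, b), (b, c)} := by
      rw [ho]; ext; simp only [Set.mem_insert_iff, Set.mem_singleton_iff]; tauto
    obtain ⟨t, h1, h2⟩ := key a b c hab hbc hca aab n1 ho
    obtain ⟨t', h1', h2'⟩ := key b c a hbc hca hab abc n2 r1
    obtain ⟨t'', h1'', h2''⟩ := key c a b hca hab hbc aca n3 r2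
    intro d hd
    rw [ho] at hd
    rcases hd with rfl | rfl | rfl
    · exact ⟨t, by rw [← h1, ← h2]⟩
    · exact ⟨t', by rw [← h1', ← h2']⟩
    · exact ⟨t'', by rw [← h1'', ← h2'']⟩
  obtain ⟨y, hy⟩ := R.root_external (i + 1)
  obtain ⟨t, ht⟩ := key' _ hy
  simp only [Prod.mk.injEq] at ht
  have : i = t := by simpa using R.root_injective ht.1
  rw [this, ← ht.2, ← this]
  exact hy

theorem adj_root [Finite V] {v : V} (hv : G.IsInternal v) (i : Fin 3) :
    G.graph.Adj (R.root (i + 1)) (R.root i) :=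
  G.adj_of_mem_outerFace (R.root_mem_outerFace hv i)

/-- The external face takes up the angle at `root i` from `root (i + 2)` to `root (i + 1)`. -/
theorem next_root [Finite V] {v : V} (hv : G.IsInternal v) (i : Fin 3) :
    G.rot.next (R.root i) (R.root (i + 2)) = R.root (i + 1) := by
  have h1 := G.faceStep_mem_outerFace (R.root_mem_outerFace hv i)
  have h2 := R.root_mem_outerFace hv (i + 2)
  rw [fin_three_add_two_add_one] at h2
  rw [← G.outerFace_unique h1 h2]
  simp


/-! ### The counterclockwise preorder of a spanning tree -/

section Preorder

variable (i : Fin 3)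

theorem spanParent_of_isInternal {v : V} (hv : G.IsInternal v) :
    R.spanParent i v = R.parent i v := if_pos hv

theorem spanParent_of_isExternal {v : V} (hv : G.IsExternal v) :
    R.spanParent i v = R.root i := if_neg fun h => h hv

theorem spanParent_root : R.spanParent i (R.root i) = R.root i :=
  R.spanParent_of_isExternal i (R.root_external i)

theorem isAncestor_root (v : V) : R.IsAncestor i (R.root i) v := by
  by_cases hv : G.IsInternal v
  · obtain ⟨k, hk⟩ := R.reaches_root i v hv
    induction k generalizing v with
    | zero => exact ⟨0, hk⟩
    | succ k ih =>
      rw [Function.iterate_succ_apply, ← R.spanParent_of_isInternal i hv] at hk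
      by_cases hp : G.IsInternal (R.spanParent i v)
      · obtain ⟨l, hl⟩ := ih _ hp hk
        exact ⟨l + 1, by rwa [Function.iterate_succ_apply]⟩
      · exact ⟨2, by
          change R.spanParent i (R.spanParent i v) = _
          exact R.spanParent_of_isExternal i (not_not.1 hp)⟩
  · exact ⟨1, R.spanParent_of_isExternal i (not_not.1 hv)⟩

variable {R i}

theorem IsAncestor.refl (v : V) : R.IsAncestor i v v := ⟨0, rfl⟩

theorem IsAncestor.trans {u v w : V} (h : R.IsAncestor i u v) (h' : R.IsAncestor i v w) :
    R.IsAncestor i u w := by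
  obtain ⟨k, rfl⟩ := h
  obtain ⟨l, rfl⟩ := h'
  exact ⟨k + l, Function.iterate_add_apply _ _ _ _⟩

theorem IsAncestor.antisymm {u v : V} (h : R.IsAncestor i u v) (h' : R.IsAncestor i v u) :
    u = v := by
  obtain ⟨k, hk⟩ := h
  obtain ⟨l, hl⟩ := h'
  rcases Nat.eq_zero_or_pos k with rfl | hpos
  · exact hk.symm
  -- a node on a cycle is its own ancestor at arbitrary distances, hence the root
  have hper : (R.spanParent i)^[l + k] v = v := by rw [Function.iterate_add_apply, hk, hl]
  obtain ⟨t, ht⟩ := R.isAncestor_root i v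
  have hv : v = R.root i := by
    have h1 : (R.spanParent i)^[(l + k) * t] v = v := by
      rw [Function.iterate_mul, Function.iterate_fixed hper]
    have h2 : t ≤ (l + k) * t := Nat.le_mul_of_pos_left _ (by omega)
    obtain ⟨s, hs⟩ := Nat.exists_eq_add_of_le' h2
    rw [hs, Function.iterate_add_apply, ht, Function.iterate_fixed (R.spanParent_root i)] at h1
    exact h1.symm
  rw [← hk, hv, Function.iterate_fixed (R.spanParent_root i)]

theorem IsAncestor.total {u v w : V} (h : R.IsAncestor i u w) (h' : R.IsAncestor i v w) :
    R.IsAncestor i u v ∨ R.IsAncestor i v u := by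
  obtain ⟨k, rfl⟩ := h
  obtain ⟨l, rfl⟩ := h'
  rcases le_total k l with hkl | hkl <;> obtain ⟨s, rfl⟩ := Nat.exists_eq_add_of_le' hkl
  · exact Or.inr ⟨s, (Function.iterate_add_apply _ _ _ _).symm⟩
  · exact Or.inl ⟨s, (Function.iterate_add_apply _ _ _ _).symm⟩

theorem IsChild.isAncestor {w a : V} (h : R.IsChild i w a) : R.IsAncestor i w a := ⟨1, h.2⟩

theorem IsAncestor.eq_or_of_isChild {u w a : V} (h : R.IsAncestor i u a) (ha : R.IsChild i w a) :
    u = a ∨ R.IsAncestor i u w := by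
  obtain ⟨k, rfl⟩ := h
  cases k with
  | zero => exact Or.inl rfl
  | succ k => exact Or.inr ⟨k, by rw [Function.iterate_succ_apply, ha.2]⟩

theorem IsChild.ne {w a : V} (h : R.IsChild i w a) : w ≠ a := by
  rintro rfl
  obtain ⟨k, hk⟩ := R.isAncestor_root i w
  rw [Function.iterate_fixed h.2] at hk
  exact h.1 hk

theorem SiblingLT.trans {w a b c : V} (h : R.SiblingLT i w a b) (h' : R.SiblingLT i w b c) :
    R.SiblingLT i w a c := by
  obtain ⟨x, hx, hab⟩ := h
  obtain ⟨y, hy, hbc⟩ := h'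
  have hxy : x = y := by
    rcases hx with ⟨hw, rfl⟩ | hx <;> rcases hy with ⟨hw', rfl⟩ | hy
    · rfl
    · exact absurd ⟨y, hy⟩ hw
    · exact absurd ⟨x, hx⟩ hw'
    · exact G.outerFace_unique hx hy
  subst hxy
  exact ⟨x, hx, hab.trans hbc⟩

theorem SiblingLT.ne {w a b : V} (h : R.SiblingLT i w a b) : a ≠ b := by
  rintro rfl
  obtain ⟨x, -, h⟩ := h
  exact lt_irrefl _ h

variable (R i) in
/-- The node `u` is strictly to the left of `v` in the `i`-th spanning tree: neither is an ancestor
of the other, and `u` comes first in counterclockwise preorder. -/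
def IsLeftOf (u v : V) : Prop :=
  ∃ w a b, R.IsChild i w a ∧ R.IsChild i w b ∧ R.SiblingLT i w a b ∧
    R.IsAncestor i a u ∧ R.IsAncestor i b v

theorem IsLeftOf.mono {u v u' v' : V} (h : R.IsLeftOf i u v) (hu : R.IsAncestor i u u')
    (hv : R.IsAncestor i v v') : R.IsLeftOf i u' v' := by
  obtain ⟨w, a, b, ha, hb, hab, hau, hbv⟩ := h
  exact ⟨w, a, b, ha, hb, hab, hau.trans hu, hbv.trans hv⟩

/-- The two branching nodes lie on the path from `v` to the root, so they are comparable, and the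
higher one separates `u` from `t`. -/
theorem IsLeftOf.trans {u v t : V} (h : R.IsLeftOf i u v) (h' : R.IsLeftOf i v t) :
    R.IsLeftOf i u t := by
  obtain ⟨w, a, b, ha, hb, hab, hau, hbv⟩ := h
  obtain ⟨w', a', b', ha', hb', hab', hav', hbt'⟩ := h'
  have h1 : R.IsAncestor i b w' → R.IsLeftOf i u t := fun hw =>
    ⟨w, a, b, ha, hb, hab, hau, hw.trans (hb'.isAncestor.trans hbt')⟩
  have h2 : R.IsAncestor i a' w → R.IsLeftOf i u t := fun hw =>
    ⟨w', a', b', ha', hb', hab', hw.trans (ha.isAncestor.trans hau), hbt'⟩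
  rcases hbv.total hav' with h | h
  · rcases h.eq_or_of_isChild ha' with rfl | h
    · obtain rfl : w = w' := hb.2.symm.trans ha'.2
      exact ⟨w, a, b', ha, hb', hab.trans hab', hau, hbt'⟩
    · exact h1 h
  · rcases h.eq_or_of_isChild hb with rfl | h
    · obtain rfl : w = w' := hb.2.symm.trans ha'.2
      exact ⟨w, a, b', ha, hb', hab.trans hab', hau, hbt'⟩
    · exact h2 h

theorem IsLeftOf.not_isAncestor {u v : V} (h : R.IsLeftOf i u v) : ¬ R.IsAncestor i u v := by
  intro huv
  obtain ⟨w, a, b, ha, hb, hab, hau, hbv⟩ := h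
  rcases (hau.trans huv).total hbv with h | h
  · rcases h.eq_or_of_isChild hb with h | h
    · exact hab.ne h
    · exact ha.ne (ha.isAncestor.antisymm h)
  · rcases h.eq_or_of_isChild ha with h | h
    · exact hab.ne h.symm
    · exact hb.ne (hb.isAncestor.antisymm h)

/-- If `u` is an ancestor of `v` and `v` is to the left of `t`, then `u` precedes `t`. -/
theorem IsAncestor.precedes_of_isLeftOf {u v t : V} (h : R.IsAncestor i u v)
    (h' : R.IsLeftOf i v t) : R.Precedes i u t := by
  obtain ⟨w, a, b, ha, hb, hab, hav, hbt⟩ := h'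
  have h1 : R.IsAncestor i u w → R.Precedes i u t := by
    intro hw
    have hub := hw.trans hb.isAncestor
    refine Or.inl ⟨?_, hub.trans hbt⟩
    rintro rfl
    obtain rfl := hub.antisymm hbt
    exact hb.ne (hb.isAncestor.antisymm hw)
  rcases h.total hav with h | h
  · rcases h.eq_or_of_isChild ha with rfl | h
    · exact Or.inr ⟨w, u, b, ha, hb, hab, .refl _, hbt⟩
    · exact h1 h
  · exact Or.inr ⟨w, a, b, ha, hb, hab, h, hbt⟩

theorem Precedes.trans {u v t : V} (h : R.Precedes i u v) (h' : R.Precedes i v t) :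
    R.Precedes i u t := by
  rcases h with ⟨hne, h⟩ | h <;> rcases h' with ⟨hne', h'⟩ | h'
  · refine Or.inl ⟨?_, h.trans h'⟩
    rintro rfl
    exact hne (h.antisymm h')
  · exact h.precedes_of_isLeftOf h'
  · exact Or.inr (IsLeftOf.mono h (.refl _) h')
  · exact Or.inr (IsLeftOf.trans h h')

theorem Precedes.ne {u v : V} (h : R.Precedes i u v) : u ≠ v := by
  rcases h with h | h
  · exact h.1
  · rintro rfl
    exact IsLeftOf.not_isAncestor h (.refl _)

theorem Precedes.label_lt [Finite V] {u v : V} (h : R.Precedes i u v) :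
    R.label i u < R.label i v := by
  unfold label
  have hsub : {x | R.Precedes i x u} ⊂ {x | R.Precedes i x v} := by
    refine ⟨fun x hx => Precedes.trans hx h, fun h' => ?_⟩
    exact Precedes.ne (h' h) rfl
  have := Set.ncard_lt_ncard hsub (Set.toFinite _)
  omega

theorem wellFounded_precedes [Finite V] : WellFounded (R.Precedes i) :=
  haveI : IsTrans V (R.Precedes i) := ⟨fun _ _ _ => Precedes.trans⟩
  haveI : Std.Irrefl (R.Precedes i) := ⟨fun _ h => h.ne rfl⟩
  Finite.wellFounded_of_trans_of_irrefl _

theorem isChild_of_mem_children {a w : V} (h : a ∈ R.children i w) : R.IsChild i w a :=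
  ⟨fun h' => R.not_isInternal_root i (h' ▸ h.1),
    (R.spanParent_of_isInternal i h.1).trans h.2⟩

/-- Consecutive children of a node are in preorder. -/
theorem siblingLT_next [Finite V] {w a b : V} (ha : a ∈ R.children i w)
    (hb : b ∈ R.children i w) (hab : G.rot.next w a = b) : R.SiblingLT i w a b := by
  have key : ∀ x, G.graph.Adj w x → a ≠ x →
      G.rot.ccwSteps w (G.rot.next w x) a < G.rot.ccwSteps w (G.rot.next w x) b := by
    intro x hx hax
    have := G.rot.ccwSteps_next (G.rot.adj_next hx) (R.children_adj ha)
      (fun h => hax ((G.rot.next w).injective h))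
    rw [hab] at this
    omega
  by_cases hw : G.IsInternal w
  · refine ⟨_, Or.inl ⟨hw, rfl⟩, key _ (R.parent_adj i w hw) ?_⟩
    rintro rfl
    exact R.parent_notMem_children hw ha
  · obtain rfl : w = R.root i := by
      rw [← ha.2]
      exact R.parent_eq_root ha.1 (by rw [ha.2]; exact not_not.1 hw)
    have ho := R.root_mem_outerFace ha.1 (i + 2)
    rw [fin_three_add_two_add_one] at ho
    refine ⟨_, Or.inr ho, key _ ?_ ?_⟩
    · exact G.adj_of_mem_outerFace ho
    · rintro rfl
      exact R.not_isInternal_root _ ha.1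

theorem exists_isChild_root_isAncestor {v : V} (hv : G.IsInternal v) :
    ∃ a, a ∈ R.children i (R.root i) ∧ R.IsAncestor i a v := by
  obtain ⟨k, hk⟩ := R.reaches_root i v hv
  induction k generalizing v with
  | zero => exact absurd ((show v = _ from hk) ▸ R.root_external i) hv
  | succ k ih =>
    by_cases h : G.IsExternal (R.parent i v)
    · exact ⟨v, ⟨hv, R.parent_eq_root hv h⟩, .refl _⟩
    · obtain ⟨a, ha, hav⟩ := ih h (by rwa [Function.iterate_succ_apply] at hk)
      exact ⟨a, ha, hav.trans ⟨1, R.spanParent_of_isInternal i hv⟩⟩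

theorem isChild_root {j : Fin 3} (h : j ≠ i) : R.IsChild i (R.root i) (R.root j) :=
  ⟨fun h' => h (R.root_injective h'), R.spanParent_of_isExternal i (R.root_external j)⟩

/-! ### Smaller and larger neighbors of an internal node -/

/-- The next root is the first child of `root i`, and all internal nodes are below later ones. -/
theorem root_isLeftOf [Finite V] {v : V} (hv : G.IsInternal v) :
    R.IsLeftOf i (R.root (i + 1)) v := by
  obtain ⟨a, ha, hav⟩ := exists_isChild_root_isAncestor (R := R) (i := i) hv
  refine ⟨R.root i, R.root (i + 1), a, isChild_root (fin_three_add_one_ne i),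
    isChild_of_mem_children ha, ?_, .refl _, hav⟩
  have ho := R.root_mem_outerFace hv (i + 2)
  rw [fin_three_add_two_add_one] at ho
  refine ⟨_, Or.inr ho, ?_⟩
  rw [R.next_root hv, G.rot.ccwSteps_self]
  refine Nat.pos_of_ne_zero fun h0 => R.not_isInternal_root (i + 1) ?_
  have hadj := (R.adj_root hv i).symm
  rw [G.rot.ccwSteps_injective hadj hadj (R.children_adj ha) (G.rot.ccwSteps_self.trans h0.symm)]
  exact ha.1

/-- The previous root is the last child of `root i`, and all internal nodes are below earlier
ones. -/
theorem isLeftOf_root [Finite V] {v : V} (hv : G.IsInternal v) :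
    R.IsLeftOf i v (R.root (i + 2)) := by
  obtain ⟨a, ha, hav⟩ := exists_isChild_root_isAncestor (R := R) (i := i) hv
  refine ⟨R.root i, a, R.root (i + 2), isChild_of_mem_children ha,
    isChild_root (fin_three_add_two_ne i), ?_, hav, .refl _⟩
  have ho := R.root_mem_outerFace hv (i + 2)
  rw [fin_three_add_two_add_one] at ho
  have hx := G.adj_of_mem_outerFace ho
  refine ⟨_, Or.inr ho, lt_of_le_of_ne
    (G.rot.ccwSteps_le_of_next_eq (G.rot.adj_next hx) hx (R.children_adj ha) rfl) fun h => ?_⟩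
  have := G.rot.ccwSteps_injective (G.rot.adj_next hx) (R.children_adj ha) hx h
  exact R.not_isInternal_root _ (this ▸ ha.1)

/-- The neighbors of `v` that come, counterclockwise, after its parent and before its children in
`T i` lie to the left of `v` in the `i`-th spanning tree. -/
theorem isLeftOf_of_mem [Finite V] {v : V} (hv : G.IsInternal v) {x : V}
    (hx : x ∈ R.children (i + 2) v ∨ x = R.parent (i + 1) v) : R.IsLeftOf i x v := by
  -- Induction along the preorder and, for a fixed node `v`, along the rotation at `v`: the triangle
  -- of `v` and two consecutive neighbors `y`, `x` leaves two possible trees for the edge `xy`.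
  induction v using (wellFounded_precedes (R := R) (i := i)).induction generalizing x with
  | _ v ih =>
  have hq := R.parent_adj i v hv
  obtain ⟨k, rfl⟩ := G.rot.exists_iterate hq
    ((R.adj_iff hv).2 (hx.symm.imp (fun h => ⟨_, h⟩) fun h => ⟨_, h⟩))
  induction k with
  | zero =>
    rcases hx with hx | hx
    · exact absurd hx (R.parent_notMem_children hv)
    · exact absurd (R.parent_inj hv hx).symm (fin_three_add_one_ne i)
  | succ k ihk =>
    rw [Function.iterate_succ_apply'] at hx ⊢
    have hadj : G.graph.Adj v ((G.rot.next v)^[k] (R.parent i v)) :=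
      (G.rot.isCycleOn v).1.mapsTo.iterate k hq
    set y := (G.rot.next v)^[k] (R.parent i v) with hy
    set x := G.rot.next v y with hxy
    have hyc := R.parent_or_child_of_next i hv hadj hx
    by_cases hxi : G.IsInternal x
    swap
    · rcases hx with hx | hx
      · exact absurd hx.1 hxi
      · rw [hx, R.parent_eq_root hv (hx ▸ not_not.1 hxi)]
        exact root_isLeftOf hv
    have hqa : R.IsAncestor i (R.parent i v) v := ⟨1, R.spanParent_of_isInternal i hv⟩
    -- the neighbor `y` before `x` is the parent of `v` or lies to the left of `v`
    have hyv : y = R.parent i v ∨ R.IsLeftOf i y v := hyc.imp id fun h => ihk (Or.inl h)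
    obtain ⟨h1, h2⟩ := G.next_rotate hadj hxy.symm
    have h3 := R.next_parent_or_child (v := x) (x := v) (i + 2) hxi (by
      rw [fin_three_add_two_add_two]
      exact hx.imp (fun h => h.2.symm) fun h => ⟨hv, h.symm⟩)
    rw [h2, fin_three_add_two_add_two, fin_three_add_two_add_one] at h3
    rcases h3 with h3 | h3
    · -- `x` is the parent of `y` in `T (i + 1)`
      have hyx := ih y ?_ h3.1 (Or.inr h3.2.symm)
      · rcases hyv with h | h
        · exact hyx.mono (.refl _) (h ▸ hqa)
        · exact hyx.trans h
      · rcases hyv with h | h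
        · exact Or.inl ⟨hadj.ne.symm, h ▸ hqa⟩
        · exact Or.inr h
    · -- `y` is the parent of `x` in `T i`
      rcases hyv with h | h
      · exact ⟨y, x, v, isChild_of_mem_children ⟨hxi, h3.symm⟩,
          isChild_of_mem_children ⟨hv, h.symm⟩,
          siblingLT_next ⟨hxi, h3.symm⟩ ⟨hv, h.symm⟩ h1, .refl _, .refl _⟩
      · refine h.mono ?_ (.refl _)
        exact ⟨1, (R.spanParent_of_isInternal i hxi).trans h3.symm⟩

theorem two_add_le_degMinus [Finite V] {v : V} (hv : G.IsInternal v) :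
    2 + (R.children (i + 2) v).ncard ≤ R.degMinus i v := by
  have hne : R.parent i v ≠ R.parent (i + 1) v := fun h =>
    fin_three_add_one_ne i (R.parent_inj hv h).symm
  have hdisj : Disjoint {R.parent i v, R.parent (i + 1) v} (R.children (i + 2) v) := by
    rw [Set.disjoint_left]
    rintro _ (rfl | rfl) <;> exact R.parent_notMem_children hv
  have hcard := Set.ncard_union_eq hdisj (Set.toFinite _) (Set.toFinite _)
  rw [Set.ncard_pair hne] at hcard
  rw [← hcard]
  refine Set.ncard_le_ncard ?_ (Set.toFinite _)
  rintro x ((rfl | rfl) | hx)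
  · exact ⟨R.parent_adj i v hv, Precedes.label_lt
      (Or.inl ⟨(R.parent_adj i v hv).ne.symm, 1, R.spanParent_of_isInternal i hv⟩)⟩
  · exact ⟨R.parent_adj _ v hv, Precedes.label_lt (Or.inr (isLeftOf_of_mem hv (Or.inr rfl)))⟩
  · exact ⟨R.children_adj hx, Precedes.label_lt (Or.inr (isLeftOf_of_mem hv (Or.inl hx)))⟩

theorem one_add_le_degPlus [Finite V] {v : V} (hv : G.IsInternal v) :
    1 + (R.children i v).ncard + (R.children (i + 1) v).ncard ≤ R.degPlus i v := by
  have hdisj : Disjoint {R.parent (i + 2) v} (R.children i v) := by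
    rw [Set.disjoint_left]
    rintro _ rfl; exact R.parent_notMem_children hv
  have hdisj' : Disjoint ({R.parent (i + 2) v} ∪ R.children i v) (R.children (i + 1) v) := by
    rw [Set.disjoint_left]
    rintro x (rfl | hx) hx'
    · exact R.parent_notMem_children hv hx'
    · exact fin_three_add_one_ne i (R.children_index hx' hx)
  have hcard := Set.ncard_union_eq hdisj' (Set.toFinite _) (Set.toFinite _)
  rw [Set.ncard_union_eq hdisj (Set.toFinite _) (Set.toFinite _), Set.ncard_singleton] at hcard
  rw [← hcard]
  refine Set.ncard_le_ncard ?_ (Set.toFinite _)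
  rintro x ((rfl | hx) | hx)
  · refine ⟨R.parent_adj _ v hv, Precedes.label_lt (Or.inr ?_)⟩
    by_cases hp : G.IsInternal (R.parent (i + 2) v)
    · exact isLeftOf_of_mem hp (Or.inl ⟨hv, rfl⟩)
    · rw [R.parent_eq_root hv (not_not.1 hp)]
      exact isLeftOf_root hv
  · exact ⟨R.children_adj hx, Precedes.label_lt (Or.inl ⟨(R.children_adj hx).ne,
      (isChild_of_mem_children hx).isAncestor⟩)⟩
  · exact ⟨R.children_adj hx, Precedes.label_lt
      (Or.inr (isLeftOf_of_mem hx.1 (Or.inr hx.2.symm)))⟩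

end Preorder

/-! ### Angles without children -/

theorem mem_internalNodes [Fintype V] {v : V} : v ∈ G.internalNodes ↔ G.IsInternal v := by
  simp [internalNodes]

theorem deg_eq [Finite V] {v : V} (hv : G.IsInternal v) :
    G.deg v = 3 + ∑ j, (R.children j v).ncard := by
  have hset : G.graph.neighborSet v =
      Set.range (fun j => R.parent j v) ∪ (R.children 0 v ∪ (R.children 1 v ∪ R.children 2 v)) := by
    ext u
    simp only [SimpleGraph.mem_neighborSet, R.adj_iff hv, Set.mem_union, Set.mem_range,
      Fin.exists_fin_succ, eq_comm]
    simp
  have hdisj : ∀ j k : Fin 3, j ≠ k → Disjoint (R.children j v) (R.children k v) := by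
    intro j k hjk
    rw [Set.disjoint_left]
    exact fun u h1 h2 => hjk (R.children_index h1 h2)
  have hrange : (Set.range fun j => R.parent j v).ncard = 3 := by
    rw [← Set.image_univ, Set.ncard_image_of_injective _ fun j k h => R.parent_inj hv h]
    simp [Set.ncard_univ]
  have hpar : ∀ k, Disjoint (Set.range fun j => R.parent j v) (R.children k v) := by
    intro k
    rw [Set.disjoint_left]
    rintro _ ⟨j, rfl⟩
    exact R.parent_notMem_children hv
  rw [deg, hset, Set.ncard_union_eq, Set.ncard_union_eq, Set.ncard_union_eq (hdisj 1 2 (by decide)),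
    hrange, Fin.sum_univ_three, add_assoc]
  · rw [Set.disjoint_union_right]
    exact ⟨hdisj 0 1 (by decide), hdisj 0 2 (by decide)⟩
  · simp only [Set.disjoint_union_right]
    exact ⟨hpar 0, hpar 1, hpar 2⟩

theorem card_eq [Fintype V] (R : G.Realizer) : Fintype.card V = G.internalNodes.card + 3 := by
  classical
  have h : (Finset.univ.filter fun v => ¬ G.IsInternal v) = Finset.univ.image R.root := by
    ext v
    simp [IsInternal, R.isExternal_iff, eq_comm]
  have h' := Finset.card_filter_add_card_filter_not (s := (Finset.univ : Finset V)) G.IsInternal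
  rw [h, Finset.card_image_of_injective _ R.root_injective] at h'
  have h2 : G.internalNodes = Finset.univ.filter fun v => G.IsInternal v := by
    ext; simp [internalNodes]
  rw [h2, ← Finset.card_univ, ← h']
  simp

theorem ncard_outerFace_le : G.outerFace.ncard ≤ 3 := by
  classical
  obtain ⟨a, b, c, -, -, -, -, -, -, -, -, -, ho⟩ := G.exists_outerFace_eq
  rw [ho]
  have : ({(a, b), (b, c), (c, a)} : Set (V × V)) =
      (({(a, b), (b, c), (c, a)} : Finset (V × V)) : Set (V × V)) := by simp
  rw [this, Set.ncard_coe_finset]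
  exact Finset.card_le_three

theorem ncard_edgeSet_le [Fintype V] (R : G.Realizer) :
    G.graph.edgeSet.ncard ≤ 3 * G.internalNodes.card + 3 := by
  classical
  have hsub : G.graph.edgeSet ⊆
      ((G.internalNodes ×ˢ (Finset.univ : Finset (Fin 3))).image
        (fun p => s(p.1, R.parent p.2 p.1)) : Finset (Sym2 V)) ∪
      (fun d : V × V => s(d.1, d.2)) '' G.outerFace := by
    intro e he
    induction e using Sym2.ind with
    | _ u v =>
    rw [SimpleGraph.mem_edgeSet] at he
    by_cases h1 : (u, v) ∈ G.outerFace
    · exact Or.inr ⟨_, h1, rfl⟩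
    by_cases h2 : (v, u) ∈ G.outerFace
    · exact Or.inr ⟨_, h2, Sym2.eq_swap⟩
    left
    obtain ⟨j, hj, -⟩ := R.partition u v ⟨he, h1, h2⟩
    have key : ∀ x y : V, x ≠ y → R.parent j x = y → G.IsInternal x := by
      intro x y hxy h hx
      rw [R.parent_external j x hx] at h
      exact hxy h
    simp only [Finset.coe_image, Set.mem_image, Finset.mem_coe, Finset.mem_product,
      mem_internalNodes, Finset.mem_univ, and_true, Prod.exists]
    rcases hj with hj | hj
    · exact ⟨u, j, key u v he.ne hj, by rw [hj]⟩
    · exact ⟨v, j, key v u he.ne.symm hj, by rw [hj, Sym2.eq_swap]⟩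
  refine (Set.ncard_le_ncard hsub (Set.toFinite _)).trans ((Set.ncard_union_le _ _).trans ?_)
  gcongr
  · rw [Set.ncard_coe_finset]
    refine Finset.card_image_le.trans ?_
    rw [Finset.card_product]
    simp [mul_comm]
  · exact (Set.ncard_image_le (Set.toFinite _)).trans ncard_outerFace_le

/-- If `v` has no children in `T j`, then its parents in the other two trees follow each other. -/
theorem next_parent_of_children_eq_empty [Finite V] {v : V} (hv : G.IsInternal v) {j : Fin 3}
    (h : R.children j v = ∅) : G.rot.next v (R.parent (j + 1) v) = R.parent (j + 2) v := by
  have := R.next_parent_or_child (j + 1) hv (Or.inl rfl)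
  rw [fin_three_add_one_add_two, h] at this
  simpa [add_assoc] using this

/-- There are at most `2 n - 5` pairs `(v, j)` such that `v` has no children in `T j`: the angles
between the other two parents of such `v` belong to different internal faces. -/
theorem sum_empty_le [Fintype V] :
    ∑ v ∈ G.internalNodes, ∑ j : Fin 3, (if (R.children j v).ncard = 0 then 1 else 0) ≤
      2 * G.internalNodes.card + 1 := by
  classical
  have hfaces : G.rot.faces.ncard ≤ 2 * G.internalNodes.card + 2 := by
    have h1 := G.euler
    have h2 := R.ncard_edgeSet_le
    have h3 := R.card_eq
    rw [Nat.card_eq_fintype_card] at h1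
    omega
  have hlt : (G.rot.faces \ {G.outerFace}).ncard + 1 = G.rot.faces.ncard :=
    Set.ncard_sdiff_singleton_add_one G.outerFace_mem (Set.toFinite _)
  rw [← Finset.sum_product', ← Finset.card_filter]
  set Z := (G.internalNodes ×ˢ (Finset.univ : Finset (Fin 3))).filter
    fun p => (R.children p.2 p.1).ncard = 0 with hZ
  have hmem : ∀ p ∈ Z, G.IsInternal p.1 ∧ R.children p.2 p.1 = ∅ := by
    intro p hp
    rw [hZ, Finset.mem_filter, Finset.mem_product, mem_internalNodes,
      Set.ncard_eq_zero (Set.toFinite _)] at hp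
    exact ⟨hp.1.1, hp.2⟩
  have hle : (Z : Set (V × Fin 3)).ncard ≤ (G.rot.faces \ {G.outerFace}).ncard := by
    refine Set.ncard_le_ncard_of_injOn (fun p => G.rot.faceOf (p.1, R.parent (p.2 + 1) p.1))
      ?_ ?_ (Set.toFinite _)
    · intro p hp
      obtain ⟨hv, -⟩ := hmem p hp
      refine ⟨⟨_, R.parent_adj _ _ hv, rfl⟩, fun h => hv ?_⟩
      have h0 : (p.1, R.parent (p.2 + 1) p.1) ∈
          G.rot.faceOf (p.1, R.parent (p.2 + 1) p.1) := ⟨0, rfl⟩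
      exact ⟨_, (show _ = G.outerFace from h) ▸ h0⟩
    · -- The face of `(v, j)` is `v`, `p`, `q` with `p`, `q` parents of `v`. Were it also the face
      -- of `(p, j')` or `(q, j')`, then `v` would be a parent of `p` or `q`.
      rintro ⟨v, j⟩ hp ⟨v', j'⟩ hp' heq
      obtain ⟨hv, hj⟩ := hmem _ hp
      obtain ⟨hv', hj'⟩ := hmem _ hp'
      dsimp only at hv hj hv' hj' heq
      have hn := R.next_parent_of_children_eq_empty hv hj
      have hn' := R.next_parent_of_children_eq_empty hv' hj'
      have hadj := R.parent_adj (j + 1) v hv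
      obtain ⟨h1, h2⟩ := G.next_rotate hadj hn
      have h0 : (v', R.parent (j' + 1) v') ∈ G.rot.faceOf (v, R.parent (j + 1) v) := by
        rw [heq]; exact ⟨0, rfl⟩
      rw [G.mem_faceOf_iff hadj] at h0
      have e1 : G.rot.faceStep (v, R.parent (j + 1) v) =
          (R.parent (j + 1) v, R.parent (j + 2) v) := by
        simp only [RotationSystem.faceStep, Prod.mk.injEq, true_and]
        exact (Equiv.symm_apply_eq _).2 h1.symm
      have e2 : G.rot.faceStep (R.parent (j + 1) v, R.parent (j + 2) v) =
          (R.parent (j + 2) v, v) := by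
        simp only [RotationSystem.faceStep, Prod.mk.injEq, true_and]
        exact (Equiv.symm_apply_eq _).2 h2.symm
      rw [e1, e2] at h0
      simp only [Prod.mk.injEq] at h0
      rcases h0 with ⟨rfl, h0⟩ | ⟨h3, h4⟩ | ⟨h3, h4⟩
      · have := R.parent_inj hv h0
        rw [add_right_cancel this]
      · rw [h4, h3, h1] at hn'
        exact absurd hn'.symm (R.parent_parent_ne hv)
      · rw [h3] at h4
        exact absurd h4 (R.parent_parent_ne hv)
  rw [Set.ncard_coe_finset] at hle
  omega

/-! ### Nodes of degree three -/

/-- An internal node of degree three is the first or last child in `T j` of a node with several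
children in `T j`, unless it forms a face with two external nodes. -/
theorem exists_of_children_eq_empty [Finite V] {u : V} (hu : G.IsInternal u)
    (h0 : ∀ j, R.children j u = ∅) :
    (∃ w j, G.IsInternal w ∧ 2 ≤ (R.children j w).ncard ∧
      (u = G.rot.next w (R.parent (j + 1) w) ∨ u = (G.rot.next w).symm (R.parent (j + 2) w))) ∨
    ∃ i, u = G.rot.next (R.root i) (R.root (i + 1)) := by
  have hn : ∀ i, G.rot.next u (R.parent i u) = R.parent (i + 1) u := by
    intro i
    have := R.next_parent_of_children_eq_empty hu (h0 (i + 2))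
    rwa [fin_three_add_two_add_one, fin_three_add_two_add_two] at this
  have h1 : ∀ i, G.rot.next (R.parent i u) (R.parent (i + 1) u) = u :=
    fun i => (G.next_rotate (R.parent_adj i u hu) (hn i)).1
  have h2 : ∀ i, G.rot.next (R.parent (i + 1) u) u = R.parent i u :=
    fun i => (G.next_rotate (R.parent_adj i u hu) (hn i)).2
  by_cases hex : ∃ i, G.IsExternal (R.parent i u) ∧ G.IsExternal (R.parent (i + 1) u)
  · obtain ⟨i, hi, hi'⟩ := hex
    right
    refine ⟨i, ?_⟩
    rw [← R.parent_eq_root hu hi, ← R.parent_eq_root hu hi', h1]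
  left
  set x : Fin 3 → V := fun i => R.parent i u with hx
  have hu' : ∀ i, u ∈ R.children i (x i) := fun i => ⟨hu, rfl⟩
  -- each edge of the triangle `x 0`, `x 1`, `x 2` around `u` belongs to one of the trees
  have hedge : ∀ i, x i ∈ R.children (i + 1) (x (i + 1)) ∨ x (i + 1) ∈ R.children i (x i) := by
    intro i
    by_cases hi : G.IsInternal (x i)
    · have h3 : G.graph.Adj (x i) (x (i + 1)) :=
        G.adj_of_next (R.parent_adj i u hu) (hn i)
      have := R.parent_or_child_of_next (i + 1) hi h3 (Or.inl (by
        rw [fin_three_add_one_add_two, h1 i]; exact hu' i))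
      rw [fin_three_add_one_add_two] at this
      exact this.imp (fun h => ⟨hi, h.symm⟩) id
    · have hi' : G.IsInternal (x (i + 1)) := fun h => hex ⟨i, not_not.1 hi, h⟩
      have := R.next_parent_or_child (i + 2) hi' (x := u) (Or.inr (by
        rw [fin_three_add_two_add_two]; exact hu' (i + 1)))
      rw [h2 i, fin_three_add_two_add_two, fin_three_add_two_add_one] at this
      exact this.imp id fun h => ⟨hi', h.symm⟩
  have two_le : ∀ i, ∀ y ∈ R.children i (x i), y ≠ u → 2 ≤ (R.children i (x i)).ncard := by
    intro i y hy hyu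
    rw [← Set.ncard_pair hyu]
    refine Set.ncard_le_ncard ?_ (Set.toFinite _)
    rintro z (rfl | rfl)
    exacts [hy, hu' i]
  -- two of the three edges point in the same direction around the triangle
  have hpath : (∃ i, x (i + 2) ∈ R.children i (x i) ∧ x i ∈ R.children (i + 1) (x (i + 1))) ∨
      ∃ i, x (i + 1) ∈ R.children i (x i) ∧ x i ∈ R.children (i + 2) (x (i + 2)) := by
    have e0 := hedge 0
    have e1 := hedge 1
    have e2 := hedge 2
    simp only [Fin.exists_fin_succ, Fin.isValue]
    simp only [Fin.reduceAdd, zero_add, Fin.isValue, Fin.reduceSucc] at *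
    tauto
  rcases hpath with ⟨i, ha, hb⟩ | ⟨i, ha, hb⟩
  · refine ⟨x i, i, hb.1, two_le i _ ha (R.parent_adj _ u hu).ne.symm, Or.inl ?_⟩
    rw [hb.2, h1 i]
  · refine ⟨x i, i, hb.1, two_le i _ ha (R.parent_adj _ u hu).ne.symm, Or.inr ?_⟩
    have := h2 (i + 2)
    rw [fin_three_add_two_add_one] at this
    rw [hb.2, Equiv.eq_symm_apply]
    exact this

/-- A node has only one first and one last child in `T j`, and only three nodes are excepted. -/
theorem sum_leaf_le [Fintype V] :
    ∑ v ∈ G.internalNodes, (if ∀ j, (R.children j v).ncard = 0 then 1 else 0) ≤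
      2 * (∑ v ∈ G.internalNodes, ∑ j : Fin 3, (if 2 ≤ (R.children j v).ncard then 1 else 0)) +
        3 := by
  classical
  rw [← Finset.sum_product', ← Finset.card_filter, ← Finset.card_filter]
  set P := (G.internalNodes ×ˢ (Finset.univ : Finset (Fin 3))).filter
    fun p => 2 ≤ (R.children p.2 p.1).ncard with hP
  have hsub : (G.internalNodes.filter fun v => ∀ j, (R.children j v).ncard = 0) ⊆
      P.image (fun p => G.rot.next p.1 (R.parent (p.2 + 1) p.1)) ∪
      P.image (fun p => (G.rot.next p.1).symm (R.parent (p.2 + 2) p.1)) ∪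
      Finset.univ.image (fun i => G.rot.next (R.root i) (R.root (i + 1))) := by
    intro u hu
    simp only [Finset.mem_filter, mem_internalNodes, Set.ncard_eq_zero (Set.toFinite _)] at hu
    simp only [Finset.mem_union, Finset.mem_image, Finset.mem_univ, true_and, Prod.exists, hP,
      Finset.mem_filter, Finset.mem_product, mem_internalNodes, and_true]
    rcases R.exists_of_children_eq_empty hu.1 hu.2 with ⟨w, j, hw, hj, h | h⟩ | ⟨i, hi⟩
    · exact Or.inl (Or.inl ⟨w, j, ⟨hw, hj⟩, h.symm⟩)
    · exact Or.inl (Or.inr ⟨w, j, ⟨hw, hj⟩, h.symm⟩)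
    · exact Or.inr ⟨i, hi.symm⟩
  refine (Finset.card_le_card hsub).trans ((Finset.card_union_le _ _).trans ?_)
  refine Nat.add_le_add ((Finset.card_union_le _ _).trans ?_) (Finset.card_image_le.trans (by simp))
  rw [two_mul]
  exact Nat.add_le_add Finset.card_image_le Finset.card_image_le

/-! ### The contribution of a single node -/

/-- The lower bound for the contribution of a node with `a j` children in `T j` to the sum of the
three scores. -/
def localScore (a : Fin 3 → ℕ) : ℕ := ∑ i, min (1 + a i + a (i + 1)) (2 + a (i + 2))

theorem sum_localScore_le [Fintype V] :
    ∑ v ∈ G.internalNodes, localScore (fun j => (R.children j v).ncard) ≤ ∑ i, R.score i := by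
  unfold score
  rw [Finset.sum_comm]
  refine Finset.sum_le_sum fun v hv => Finset.sum_le_sum fun i _ => ?_
  rw [mem_internalNodes] at hv
  exact min_le_min (one_add_le_degPlus hv) (two_add_le_degMinus hv)

/-- Only a node without children contributes less than `5`. -/
theorem five_le_localScore {a : Fin 3 → ℕ} (h : 3 + ∑ j, a j ≠ 3) : 5 ≤ localScore a := by
  simp only [localScore, Fin.sum_univ_three, Fin.isValue, Fin.reduceAdd, zero_add] at *
  omega

/-- If `k` of the numbers `a j` are positive, then `3 + 2 k` is a lower bound for the contribution,
except that `(1, 1, 0)` contributes only `6`. -/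
theorem three_add_le_localScore {a : Fin 3 → ℕ} (h : 3 + ∑ j, a j ≠ 5) :
    9 ≤ localScore a + 2 * ∑ j, (if a j = 0 then 1 else 0) := by
  simp only [localScore, Fin.sum_univ_three, Fin.isValue, Fin.reduceAdd, zero_add] at *
  split_ifs <;> omega

/-- The bound for the third claim. The sum of `7` times `sum_empty_le` and `1` times `sum_leaf_le`
turns it into an average of `23 / 5`; the multipliers solve the dual of the linear program for the
least average contribution of a node. -/
theorem le_five_mul_localScore (a : Fin 3 → ℕ) :
    37 + 2 * ∑ j, (if 2 ≤ a j then 1 else 0) ≤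
      5 * localScore a + 7 * ∑ j, (if a j = 0 then 1 else 0) +
        if ∀ j, a j = 0 then 1 else 0 := by
  simp only [localScore, Fin.sum_univ_three, Fin.isValue, Fin.reduceAdd, zero_add,
    Fin.forall_fin_succ, Fin.reduceSucc, IsEmpty.forall_iff, and_true] at *
  split_ifs <;> omega

end Realizer
end PlaneTriangulation

theorem lemma4 {V : Type*} [Fintype V] (G : PlaneTriangulation V) (R : G.Realizer) :
    ((∀ v, G.IsInternal v → G.deg v ≠ 3) →
      5 * (Fintype.card V : ℝ) - 15 ≤ ∑ i : Fin 3, (R.score i : ℝ)) ∧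
    ((∀ v, G.IsInternal v → G.deg v ≠ 5) →
      5 * (Fintype.card V : ℝ) - 17 ≤ ∑ i : Fin 3, (R.score i : ℝ)) ∧
    23 * (Fintype.card V : ℝ) / 5 - 16 ≤ ∑ i : Fin 3, (R.score i : ℝ) := by
  have hcard := R.card_eq
  have hscore := R.sum_localScore_le
  have hempty := R.sum_empty_le
  have hleaf := R.sum_leaf_le
  have hcast : ∑ i : Fin 3, (R.score i : ℝ) = ((∑ i : Fin 3, R.score i : ℕ) : ℝ) := by
    push_cast; rfl
  rw [hcast]
  refine ⟨fun h => ?_, fun h => ?_, ?_⟩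
  · have h1 := Finset.card_nsmul_le_sum G.internalNodes
      (fun v => PlaneTriangulation.Realizer.localScore fun j => (R.children j v).ncard) 5
      fun v hv => PlaneTriangulation.Realizer.five_le_localScore (by
        rw [PlaneTriangulation.Realizer.mem_internalNodes] at hv
        rw [← R.deg_eq hv]; exact h v hv)
    have h2 : 5 * Fintype.card V ≤ (∑ i : Fin 3, R.score i) + 15 := by
      rw [smul_eq_mul] at h1; omega
    have h3 : (5 * Fintype.card V : ℝ) ≤ ((∑ i : Fin 3, R.score i : ℕ) : ℝ) + 15 := by
      exact_mod_cast h2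
    linarith
  · have h1 := Finset.sum_le_sum (s := G.internalNodes) fun v hv =>
      PlaneTriangulation.Realizer.three_add_le_localScore
        (a := fun j => (R.children j v).ncard) (by
        rw [PlaneTriangulation.Realizer.mem_internalNodes] at hv
        rw [← R.deg_eq hv]; exact h v hv)
    rw [Finset.sum_const, Finset.sum_add_distrib, ← Finset.mul_sum, smul_eq_mul] at h1
    have h2 : 5 * Fintype.card V ≤ (∑ i : Fin 3, R.score i) + 17 := by omega
    have h3 : (5 * Fintype.card V : ℝ) ≤ ((∑ i : Fin 3, R.score i : ℕ) : ℝ) + 17 := by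
      exact_mod_cast h2
    linarith
  · have h1 := Finset.sum_le_sum (s := G.internalNodes) fun v _ =>
      PlaneTriangulation.Realizer.le_five_mul_localScore fun j => (R.children j v).ncard
    rw [Finset.sum_add_distrib, Finset.sum_const, Finset.sum_add_distrib, Finset.sum_add_distrib,
      ← Finset.mul_sum, ← Finset.mul_sum, ← Finset.mul_sum, smul_eq_mul] at h1
    have h2 : 23 * Fintype.card V ≤ 5 * (∑ i : Fin 3, R.score i) + 80 := by omega
    have h3 : (23 * Fintype.card V : ℝ) ≤ 5 * ((∑ i : Fin 3, R.score i : ℕ) : ℝ) + 80 := by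
      exact_mod_cast h2
    linarith
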